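/- Let $R_0, R_1, R_s > 0$ and $R_0' = (1/R_0 + 1/R_s)^{-1}$, and let $\sigma > 0$. For $\epsilon \in [0,1]$ the $(\epsilon,\sigma)$-channel has input $X \in \{0,1\}$ and output $Y = L + \eta \in \mathbb{R}$, where the resistance level $L$ satisfies $\Pr(L = R_0' \mid X = 0) = \epsilon$, $\Pr(L = R_0 \mid X = 0) = 1-\epsilon$, $\Pr(L = R_1 \mid X = 1) = 1$, and $\eta \sim \mathcal{N}(0,\sigma^2)$ is independent noise; successive uses are independent. For $q \in [0,1]$ let $C_q(\epsilon,\sigma) = I(X;Y)$, in bits, when $\Pr(X=1) = q = 1 - \Pr(X=0)$. Let $F$ be a probability mass function on $[0,1]$ with mean $\bar\epsilon = \sum_\epsilon \epsilon F(\epsilon)$, and let $M \ge 1$. In the block-varying channel with block length $M$, the input is a sequence of $T$ blocks of $M$ bits; parameters $\epsilon^1,\dots,\epsilon^T$ are drawn i.i.d. from $F$, known to neither encoder nor decoder, and given these the symbols of block $t$ pass through independent uses of the $(\epsilon^t,\sigma)$-channel. A $T$-block code has $K \ge 1$ messages, an encoder that assigns to each message a codeword in $\{0,1\}^{MT}$,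 and a measurable decoder from $\mathbb{R}^{MT}$ to the messages. Its rate is $\frac{1}{MT}\log_2 K$ and its error probability is that for equiprobable messages; its input distribution is the distribution of the code symbol at a uniformly random position of the codeword of a uniformly random message. A real number $R$ is achievable for the input distribution Bernoulli$(q)$ as $T \to \infty$ if for every $\delta > 0$ and all sufficiently large $T$ there is a $T$-block code with rate at least $R - \delta$, error probability at most $\delta$, and input distribution Bernoulli$(q')$ with $|q' - q| \le \delta$. Then the set of achievable rates has a maximum $R$, and $$C_q(\bar\epsilon,\sigma) \;\le\; R \;\le\; \sum_\epsilon F(\epsilon)\, C_q(\epsilon,\sigma).$$ -/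

import Mathlib

open MeasureTheory ProbabilityTheory Filter

noncomputable section

/-- Mutual information `I(X;Y)`, in bits, of an input with law `μ` and the output of the channel `κ`:
the Kullback-Leibler divergence of the joint law from the product of its marginals. -/
def mutualInfo {α β : Type*} [MeasurableSpace α] [MeasurableSpace β]
    (μ : Measure α) (κ : Kernel α β) : ℝ :=
  (InformationTheory.klDiv (Measure.compProd μ κ) (μ.prod (μ.bind κ))).toReal / Real.log 2

/-- The resistances of a memory: high state `R0` (logical `0`), low state `R1` (logical `1`),
parasitic resistance `Rs` of a sneak path. -/
structure Resistances where
  R0 : ℝ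
  R1 : ℝ
  Rs : ℝ
  R0_pos : 0 < R0
  R1_pos : 0 < R1
  Rs_pos : 0 < Rs

/-- The degraded resistance `R0' = (1/R0 + 1/Rs)⁻¹`. -/
def Resistances.R0' (r : Resistances) : ℝ := (1 / r.R0 + 1 / r.Rs)⁻¹

/-- Binary-input, ternary-output asymmetrical discrete channel (`false` is the bit `0`, `true` the
bit `1`): `Pr(R0' | 0) = ε`, `Pr(R0 | 0) = 1 - ε`, `Pr(R1 | 1) = 1`. -/
def levelLaw (r : Resistances) (ε : unitInterval) : Bool → Measure ℝ
  | false => bernoulliMeasure r.R0' r.R0 ε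
  | true => Measure.dirac r.R1

/-- The `(ε, σ)`-channel: the resistance level plus independent Gaussian noise `N(0, σ²)`. -/
def esChannel (r : Resistances) (σ : ℝ) (ε : unitInterval) : Kernel Bool ℝ :=
  Kernel.ofFunOfCountable fun x =>
    Measure.conv (levelLaw r ε x) (gaussianReal 0 (Real.toNNReal (σ ^ 2)))

/-- `C_q(ε, σ) = I(X;Y)` for the `(ε, σ)`-channel with `Pr(X = 1) = q`, in bits. -/
def capacityQ (r : Resistances) (q : unitInterval) (ε : unitInterval) (σ : ℝ) : ℝ :=
  mutualInfo (bernoulliMeasure true false q) (esChannel r σ ε)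

theorem tsum_pmf_mul_mem (F : PMF unitInterval) : ∑' ε : unitInterval, (F ε).toReal * (ε : ℝ) ∈ Set.Icc (0 : ℝ) 1 := by
  have hF : Summable fun ε : unitInterval => (F ε).toReal :=
    ENNReal.summable_toReal (by rw [F.tsum_coe]; exact ENNReal.one_ne_top)
  have h1 : ∑' ε : unitInterval, (F ε).toReal = 1 := by
    rw [← ENNReal.tsum_toReal_eq (fun ε => F.apply_ne_top ε), F.tsum_coe]; simp
  have hle : ∀ ε : unitInterval, (F ε).toReal * (ε : ℝ) ≤ (F ε).toReal := fun ε =>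
    mul_le_of_le_one_right ENNReal.toReal_nonneg ε.2.2
  have hnn : ∀ ε : unitInterval, 0 ≤ (F ε).toReal * (ε : ℝ) := fun ε =>
    mul_nonneg ENNReal.toReal_nonneg ε.2.1
  refine ⟨tsum_nonneg hnn, ?_⟩
  rw [← h1]
  exact (Summable.of_nonneg_of_le hnn hle hF).tsum_le_tsum hle hF

/-- The mean `ε̄ = ∑ ε F(ε)` of the channel parameter. -/
def meanParam (F : PMF unitInterval) : unitInterval := ⟨∑' ε : unitInterval, (F ε).toReal * (ε : ℝ), tsum_pmf_mul_mem F⟩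

/-- `∑_ε F(ε) C_q(ε, σ)`. -/
def averageCapacity (r : Resistances) (q : unitInterval) (F : PMF unitInterval) (σ : ℝ) : ℝ :=
  ∑' ε : unitInterval, (F ε).toReal * capacityQ r q ε σ

/-- Output law of one block of length `M` with input `x`: a parameter `ε` is drawn from `F` (and is
revealed to nobody); given `ε`, the `M` symbols pass independently through the `(ε, σ)`-channel. -/
def blockLaw (r : Resistances) (σ : ℝ) (F : PMF unitInterval) {M : ℕ} (x : Fin M → Bool) :
    Measure (Fin M → ℝ) :=
  Measure.sum fun ε : unitInterval => F ε • Measure.pi fun j => esChannel r σ ε (x j)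

/-- Output law of `T` blocks with input `x`: the parameters of the blocks are independent. -/
def blockVaryingLaw (r : Resistances) (σ : ℝ) (F : PMF unitInterval) {T M : ℕ} (x : Fin T → Fin M → Bool) :
    Measure (Fin T → Fin M → ℝ) :=
  Measure.pi fun t => blockLaw r σ F (x t)

/-- A code with joint encoding and decoding over `T` blocks of length `M`. -/
structure BlockCode (T M : ℕ) where
  /-- the number of messages -/
  K : ℕ
  K_pos : 0 < K
  enc : Fin K → Fin T → Fin M → Bool
  dec : (Fin T → Fin M → ℝ) → Fin K
  measurable_dec : Measurable dec

namespace BlockCode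

variable {T M : ℕ}

/-- Code rate, in bits per channel symbol; the code length is `M * T`. -/
def rate (c : BlockCode T M) : ℝ := Real.logb 2 c.K / (M * T)

/-- Probability of a decoding error for equiprobable messages. -/
def errorProb (c : BlockCode T M) (r : Resistances) (σ : ℝ) (F : PMF unitInterval) : ℝ :=
  (∑ w : Fin c.K, (blockVaryingLaw r σ F (c.enc w)).real {y | c.dec y ≠ w}) / c.K

/-- Probability that a code symbol is `1`, for an equiprobable message and an equiprobable
position. -/
def inputProb (c : BlockCode T M) : ℝ :=
  (∑ w : Fin c.K, ∑ t : Fin T, ∑ j : Fin M, if c.enc w t j = true then (1 : ℝ) else 0) /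
    (c.K * (M * T))

end BlockCode

/-- `R` is achievable for the input distribution Bernoulli(`q`) as `T → ∞`: for all large `T` there
are `T`-block codes whose rate is at least `R`, whose error probability is zero and whose input
distribution is Bernoulli(`q`), each up to an arbitrarily small `δ`. -/
def IsAchievableRate (r : Resistances) (σ : ℝ) (F : PMF unitInterval) (q : unitInterval) (M : ℕ) (R : ℝ) : Prop :=
  ∀ δ : ℝ, 0 < δ → ∀ᶠ T : ℕ in atTop, ∃ c : BlockCode T M,
    R - δ ≤ c.rate ∧ c.errorProb r σ F ≤ δ ∧ |c.inputProb - q| ≤ δ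

end

/-! Upper bound: compare the output law of a code with a reference law that draws a fresh `ε` from
`F` for each block and then emits i.i.d. symbols from the output law of the `(ε, σ)`-channel under
Bernoulli(`q`) input. A block law is a mixture over the same `ε`, so by joint convexity
(`RelEntropyLE.pmf_sum`) its relative entropy is at most the `F`-average of the relative entropies
for fixed `ε`, which add up over the symbols (`RelEntropyLE.pi`). A Fano-type converse
(`sum_correct_mul_log_le`) turns this into a bound on the rate.

Lower bound: the channel is affine in `ε`, so each single symbol, averaged over `ε`, sees the
channel with parameter `meanParam F` (`sum_esChannel`), although the symbols of a block are
dependent. The decoder scores codewords by the product of the likelihood ratios of that mean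
channel. For every output `y` the scores of random codewords average to `1`, so wrong codewords
rarely score high whatever the true output law is (`exists_codebook`). The log-score of the sent
codeword is a sum over independent blocks whose expectation depends only on one-symbol marginals, so
Chebyshev's inequality concentrates it near `MT` times the mutual information of the mean channel
(`exists_blockVaryingLaw_score_bound`).

The slack `δ` in the notion of achievability makes the set of achievable rates closed under suprema,
hence the maximum. -/

/-- The relative entropy of `P` with respect to `Q` is at most `D` (in nats), in the variational
form of Donsker and Varadhan. -/
def RelEntropyLE {α : Type*} [MeasurableSpace α] (P Q : Measure α) (D : ℝ) : Prop :=
  ∀ f : α → ℝ, Measurable f → (∃ B, ∀ x, |f x| ≤ B) →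
    ∫ x, f x ∂P ≤ D + Real.log (∫ x, Real.exp (f x) ∂Q)

/-! ### Calculus of relative entropy in variational form -/

section RelEntropy

variable {α β : Type*} [MeasurableSpace α] [MeasurableSpace β]

theorem integrable_of_abs_le {P : Measure α} [IsFiniteMeasure P] {f : α → ℝ} (hf : Measurable f)
    {B : ℝ} (hB : ∀ x, |f x| ≤ B) : Integrable f P :=
  Integrable.of_bound hf.aestronglyMeasurable B (ae_of_all _ hB)

theorem integrable_exp_of_abs_le {P : Measure α} [IsFiniteMeasure P] {f : α → ℝ}
    (hf : Measurable f) {B : ℝ} (hB : ∀ x, |f x| ≤ B) :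
    Integrable (fun x => Real.exp (f x)) P :=
  integrable_of_abs_le (B := Real.exp B) (by fun_prop) fun x => by
    rw [abs_of_pos (Real.exp_pos _)]
    exact Real.exp_le_exp.2 ((le_abs_self _).trans (hB x))

theorem exp_neg_le_integral_exp {P : Measure α} [IsProbabilityMeasure P] {f : α → ℝ}
    (hf : Measurable f) {B : ℝ} (hB : ∀ x, |f x| ≤ B) :
    Real.exp (-B) ≤ ∫ x, Real.exp (f x) ∂P := by
  have h := integral_mono (μ := P) (integrable_const (Real.exp (-B)))
    (integrable_exp_of_abs_le hf hB)
    (fun x => Real.exp_le_exp.2 (by have := neg_abs_le (f x); linarith [hB x]))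
  simpa using h

theorem integral_exp_le {P : Measure α} [IsProbabilityMeasure P] {f : α → ℝ}
    (hf : Measurable f) {B : ℝ} (hB : ∀ x, |f x| ≤ B) :
    ∫ x, Real.exp (f x) ∂P ≤ Real.exp B := by
  have h := integral_mono (μ := P) (integrable_exp_of_abs_le hf hB)
    (integrable_const (Real.exp B))
    (fun x => Real.exp_le_exp.2 ((le_abs_self _).trans (hB x)))
  simpa using h

theorem RelEntropyLE.mono {P Q : Measure α} {D D' : ℝ} (h : RelEntropyLE P Q D) (hD : D ≤ D') :
    RelEntropyLE P Q D' := fun f hf hB => (h f hf hB).trans (by linarith)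

theorem RelEntropyLE.nonneg {P Q : Measure α} [IsProbabilityMeasure Q] {D : ℝ}
    (h : RelEntropyLE P Q D) : 0 ≤ D := by
  simpa using h (fun _ => 0) measurable_const ⟨0, by simp⟩

theorem integral_ofReal_withDensity {Q : Measure α} {ρ : α → ℝ} (hρ : Measurable ρ)
    (h0 : ∀ x, 0 ≤ ρ x) (g : α → ℝ) :
    ∫ x, g x ∂(Q.withDensity fun x => ENNReal.ofReal (ρ x)) = ∫ x, ρ x * g x ∂Q := by
  rw [integral_withDensity_eq_integral_toReal_smul (by fun_prop) (by simp)]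
  simp [ENNReal.toReal_ofReal (h0 _)]

theorem integrable_ofReal_withDensity_iff {Q : Measure α} {ρ : α → ℝ} (hρ : Measurable ρ)
    (h0 : ∀ x, 0 ≤ ρ x) (g : α → ℝ) :
    Integrable g (Q.withDensity fun x => ENNReal.ofReal (ρ x)) ↔
      Integrable (fun x => ρ x * g x) Q := by
  rw [integrable_withDensity_iff_integrable_smul' (by fun_prop) (by simp)]
  simp [ENNReal.toReal_ofReal (h0 _)]

theorem ae_pos_withDensity {Q : Measure α} {ρ : α → ℝ} (hρ : Measurable ρ) :
    ∀ᵐ x ∂(Q.withDensity fun x => ENNReal.ofReal (ρ x)), 0 < ρ x := by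
  rw [ae_withDensity_iff (by fun_prop)]
  exact ae_of_all _ fun x hx => by simpa using hx

/-- Integrate `log t ≤ t - 1` at `t = exp f / (ρ c)` against `P`, where `c` is the `Q`-integral of
`exp f`; the `P`-integral of `t` is at most `1`. -/
theorem RelEntropyLE.of_withDensity {P Q : Measure α} [IsProbabilityMeasure P]
    [IsProbabilityMeasure Q] {ρ : α → ℝ} (hρ : Measurable ρ) (h0 : ∀ x, 0 ≤ ρ x)
    (hP : P = Q.withDensity fun x => ENNReal.ofReal (ρ x))
    (hint : Integrable (fun x => Real.log (ρ x)) P) :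
    RelEntropyLE P Q (∫ x, Real.log (ρ x) ∂P) := by
  rintro f hf ⟨B, hB⟩
  set c := ∫ x, Real.exp (f x) ∂Q
  have hc : 0 < c := (Real.exp_pos _).trans_le (exp_neg_le_integral_exp hf hB)
  have hfi : Integrable f P := integrable_of_abs_le hf hB
  -- Only an inequality: where `ρ` vanishes, the quotient takes the value `0`.
  have hbound : ∀ x, ρ x * (Real.exp (f x) / (ρ x * c)) ≤ Real.exp (f x) / c := fun x => by
    rcases (h0 x).eq_or_lt with h | h
    · rw [← h]; simp; positivity
    · rw [← mul_div_assoc, mul_div_mul_left _ _ h.ne']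
  have hQi : Integrable (fun x => Real.exp (f x) / c) Q :=
    (integrable_exp_of_abs_le hf hB).div_const c
  have hi2 : Integrable (fun x => ρ x * (Real.exp (f x) / (ρ x * c))) Q := by
    refine hQi.mono' (by fun_prop) (ae_of_all _ fun x => ?_)
    rw [Real.norm_of_nonneg (mul_nonneg (h0 x)
      (div_nonneg (Real.exp_pos _).le (mul_nonneg (h0 x) hc.le)))]
    exact hbound x
  have hi : Integrable (fun x => Real.exp (f x) / (ρ x * c)) P := by
    rw [hP, integrable_ofReal_withDensity_iff hρ h0]
    exact hi2
  have hle : ∫ x, Real.exp (f x) / (ρ x * c) ∂P ≤ 1 := by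
    rw [hP, integral_ofReal_withDensity hρ h0]
    calc _ ≤ ∫ x, Real.exp (f x) / c ∂Q := integral_mono hi2 hQi hbound
      _ = 1 := by rw [integral_div]; exact div_self hc.ne'
  have hmono : ∫ x, (f x - Real.log (ρ x) - Real.log c) ∂P
      ≤ ∫ x, (Real.exp (f x) / (ρ x * c) - 1) ∂P := by
    refine integral_mono_ae ((hfi.sub hint).sub (integrable_const _))
      (hi.sub (integrable_const _)) ?_
    have hpos : ∀ᵐ x ∂P, 0 < ρ x := by rw [hP]; exact ae_pos_withDensity hρ
    filter_upwards [hpos] with x hx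
    have h := Real.log_le_sub_one_of_pos (x := Real.exp (f x) / (ρ x * c)) (by positivity)
    rw [Real.log_div (Real.exp_pos _).ne' (by positivity), Real.log_exp,
      Real.log_mul hx.ne' hc.ne'] at h
    linarith
  have hfl : Integrable (fun x => f x - Real.log (ρ x)) P := hfi.sub hint
  rw [integral_sub hfl (integrable_const _), integral_sub hfi hint,
    integral_sub hi (integrable_const _)] at hmono
  simp at hmono
  linarith

theorem RelEntropyLE.refl (P : Measure α) [IsProbabilityMeasure P] : RelEntropyLE P P 0 := by
  have h := RelEntropyLE.of_withDensity (P := P) (Q := P) (ρ := fun _ => 1) (by fun_prop)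
    (by simp) (by simp) (by simp)
  simpa using h

/-- Apply the second bound to the sections of `f`, then the first bound to the logarithm `log (h x)`
of the inner exponential integral, which is again bounded by `B`. -/
theorem RelEntropyLE.prod {P₁ Q₁ : Measure α} {P₂ Q₂ : Measure β} [IsProbabilityMeasure P₁]
    [IsProbabilityMeasure Q₁] [IsProbabilityMeasure P₂] [IsProbabilityMeasure Q₂] {D₁ D₂ : ℝ}
    (h₁ : RelEntropyLE P₁ Q₁ D₁) (h₂ : RelEntropyLE P₂ Q₂ D₂) :
    RelEntropyLE (P₁.prod P₂) (Q₁.prod Q₂) (D₁ + D₂) := by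
  rintro f hf ⟨B, hB⟩
  set h : α → ℝ := fun x => ∫ y, Real.exp (f (x, y)) ∂Q₂ with hh
  have hfx : ∀ x, Measurable fun y => f (x, y) := fun x => hf.comp measurable_prodMk_left
  have hlow : ∀ x, Real.exp (-B) ≤ h x := fun x =>
    exp_neg_le_integral_exp (hfx x) fun y => hB (x, y)
  have hpos : ∀ x, 0 < h x := fun x => (Real.exp_pos _).trans_le (hlow x)
  have hup : ∀ x, h x ≤ Real.exp B := fun x => integral_exp_le (hfx x) fun y => hB (x, y)
  have hmeas : Measurable h :=
    (StronglyMeasurable.integral_prod_right (f := fun x y => Real.exp (f (x, y)))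
      (by apply Measurable.stronglyMeasurable; unfold Function.uncurry; fun_prop)).measurable
  have hlog : ∀ x, |Real.log (h x)| ≤ B := fun x => by
    rw [abs_le]
    exact ⟨(Real.le_log_iff_exp_le (hpos x)).2 (hlow x), (Real.log_le_iff_le_exp (hpos x)).2 (hup x)⟩
  have hfi : Integrable f (P₁.prod P₂) := integrable_of_abs_le hf hB
  rw [integral_prod f hfi]
  have hstep : ∫ x, ∫ y, f (x, y) ∂P₂ ∂P₁ ≤ ∫ x, (D₂ + Real.log (h x)) ∂P₁ :=
    integral_mono hfi.integral_prod_left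
      ((integrable_const _).add (integrable_of_abs_le (by fun_prop) hlog))
      fun x => h₂ _ (hfx x) ⟨B, fun y => hB (x, y)⟩
  rw [integral_add (integrable_const _) (integrable_of_abs_le (by fun_prop) hlog)] at hstep
  have h1 := h₁ (fun x => Real.log (h x)) (by fun_prop) ⟨B, hlog⟩
  simp_rw [Real.exp_log (hpos _)] at h1
  rw [integral_prod _ (integrable_exp_of_abs_le hf hB)]
  simp at hstep
  linarith

theorem RelEntropyLE.map {P Q : Measure α} {D : ℝ} (h : RelEntropyLE P Q D) {g : α → β}
    (hg : Measurable g) : RelEntropyLE (P.map g) (Q.map g) D := by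
  rintro f hf ⟨B, hB⟩
  rw [integral_map hg.aemeasurable (by fun_prop), integral_map hg.aemeasurable (by fun_prop)]
  exact h (fun x => f (g x)) (by fun_prop) ⟨B, fun x => hB _⟩

theorem RelEntropyLE.pi {n : ℕ} {P Q : Fin n → Measure α} [∀ i, IsProbabilityMeasure (P i)]
    [∀ i, IsProbabilityMeasure (Q i)] {D : Fin n → ℝ} (h : ∀ i, RelEntropyLE (P i) (Q i) (D i)) :
    RelEntropyLE (Measure.pi P) (Measure.pi Q) (∑ i, D i) := by
  induction n with
  | zero =>
    have : P = Q := funext fun i => i.elim0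
    subst this
    simpa using RelEntropyLE.refl _
  | succ n ih =>
    have h1 := (measurePreserving_piFinSuccAbove P 0).symm
    have h2 := (measurePreserving_piFinSuccAbove Q 0).symm
    rw [← h1.map_eq, ← h2.map_eq, Fin.sum_univ_succ]
    refine RelEntropyLE.map ?_ (MeasurableEquiv.measurable _)
    exact (h 0).prod (ih fun i => h _)

theorem pmf_summable_toReal {ι : Type*} (F : PMF ι) : Summable fun i => (F i).toReal :=
  ENNReal.summable_toReal (by rw [F.tsum_coe]; exact ENNReal.one_ne_top)

theorem pmf_hasSum_toReal {ι : Type*} (F : PMF ι) : HasSum (fun i => (F i).toReal) 1 := by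
  have h := (pmf_summable_toReal F).hasSum
  rwa [← ENNReal.tsum_toReal_eq (fun i => F.apply_ne_top i), F.tsum_coe, ENNReal.toReal_one] at h

theorem pmf_summable_toReal_mul {ι : Type*} (F : PMF ι) {D : ι → ℝ} {B : ℝ}
    (hD : ∀ i, |D i| ≤ B) : Summable fun i => (F i).toReal * D i := by
  refine Summable.of_norm_bounded ((pmf_summable_toReal F).mul_right B) fun i => ?_
  rw [norm_mul, Real.norm_of_nonneg ENNReal.toReal_nonneg]
  exact mul_le_mul_of_nonneg_left (hD i) ENNReal.toReal_nonneg

theorem isProbabilityMeasure_sum_pmf_smul {ι : Type*} (F : PMF ι) (P : ι → Measure α)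
    [∀ i, IsProbabilityMeasure (P i)] :
    IsProbabilityMeasure (Measure.sum fun i => F i • P i) :=
  ⟨by simp [Measure.sum_apply, F.tsum_coe]⟩

theorem hasSum_integral_pmf {ι : Type*} (F : PMF ι) {P : ι → Measure α} {f : α → ℝ}
    (hf : Integrable f (Measure.sum fun i => F i • P i)) :
    HasSum (fun i => (F i).toReal * ∫ x, f x ∂P i)
      (∫ x, f x ∂(Measure.sum fun i => F i • P i)) := by
  simpa [integral_smul_measure] using hasSum_integral_measure hf

/-- Joint convexity. The logarithms of the component integrals are bounded by the tangent of `log`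
at their average `c`; the linear terms then average out to `log c`. -/
theorem RelEntropyLE.pmf_sum {ι : Type*} (F : PMF ι) {P Q : ι → Measure α}
    [∀ i, IsProbabilityMeasure (P i)] [∀ i, IsProbabilityMeasure (Q i)] {D : ι → ℝ} {C : ℝ}
    (hD : HasSum (fun i => (F i).toReal * D i) C) (h : ∀ i, RelEntropyLE (P i) (Q i) (D i)) :
    RelEntropyLE (Measure.sum fun i => F i • P i) (Measure.sum fun i => F i • Q i) C := by
  rintro f hf ⟨B, hB⟩
  have := isProbabilityMeasure_sum_pmf_smul F P
  have := isProbabilityMeasure_sum_pmf_smul F Q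
  set c := ∫ x, Real.exp (f x) ∂(Measure.sum fun i => F i • Q i)
  have hc : 0 < c := (Real.exp_pos _).trans_le (exp_neg_le_integral_exp hf hB)
  have hP := hasSum_integral_pmf F (P := P) (integrable_of_abs_le hf hB)
  have hQ := hasSum_integral_pmf F (P := Q) (integrable_exp_of_abs_le hf hB)
  have hR := (hD.add (hQ.div_const c)).add ((pmf_hasSum_toReal F).mul_right (Real.log c - 1))
  have key := hasSum_le (fun i => ?_) hP hR
  · rw [div_self hc.ne'] at key
    linarith
  · have hci : 0 < ∫ x, Real.exp (f x) ∂Q i :=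
      (Real.exp_pos _).trans_le (exp_neg_le_integral_exp hf hB)
    have h1 := h i f hf ⟨B, hB⟩
    have h2 := Real.log_le_sub_one_of_pos (div_pos hci hc)
    rw [Real.log_div hci.ne' hc.ne'] at h2
    calc _ ≤ (F i).toReal * (D i + ((∫ x, Real.exp (f x) ∂Q i) / c + (Real.log c - 1))) :=
          mul_le_mul_of_nonneg_left (by linarith) ENNReal.toReal_nonneg
      _ = _ := by ring

end RelEntropy

instance (r : Resistances) (ε : unitInterval) (x : Bool) : IsProbabilityMeasure (levelLaw r ε x) := by
  cases x <;> simp only [levelLaw] <;> infer_instance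

instance (r : Resistances) (σ : ℝ) (ε : unitInterval) : IsMarkovKernel (esChannel r σ ε) :=
  ⟨fun x => by
    change IsProbabilityMeasure (Measure.conv (levelLaw r ε x) _)
    infer_instance⟩

instance (r : Resistances) (σ : ℝ) (F : PMF unitInterval) {M : ℕ} (x : Fin M → Bool) :
    IsProbabilityMeasure (blockLaw r σ F x) :=
  isProbabilityMeasure_sum_pmf_smul F _

instance (r : Resistances) (σ : ℝ) (F : PMF unitInterval) {T M : ℕ} (x : Fin T → Fin M → Bool) :
    IsProbabilityMeasure (blockVaryingLaw r σ F x) := by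
  unfold blockVaryingLaw
  infer_instance

/-! ### Converse: bounding the rate by relative entropies -/

section Converse

/-- A weak converse of Fano type, from a reference output law `Q`. -/
theorem sum_correct_mul_log_le {Y : Type*} [MeasurableSpace Y] {K : ℕ} (hK : 0 < K)
    {P : Fin K → Measure Y} {Q : Measure Y} [∀ w, IsProbabilityMeasure (P w)]
    [IsProbabilityMeasure Q] {D : Fin K → ℝ} (h : ∀ w, RelEntropyLE (P w) Q (D w))
    {dec : Y → Fin K} (hdec : Measurable dec) :
    (∑ w, (P w).real {y | dec y = w}) * Real.log K ≤ ∑ w, D w + K := by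
  have hK1 : (1 : ℝ) ≤ K := by exact_mod_cast hK
  have hset : ∀ w, MeasurableSet {y | dec y = w} := fun w =>
    hdec (measurableSet_singleton w)
  have hstep : ∀ w, (P w).real {y | dec y = w} * Real.log K
      ≤ D w + K * Q.real {y | dec y = w} := fun w => by
    -- The test function is `log K` on the event of correct decoding and `0` elsewhere; the
    -- logarithmic term is then at most `K` times the `Q`-probability of that event.
    have h1 := h w ({y | dec y = w}.indicator fun _ => Real.log K)
      (measurable_const.indicator (hset w)) ⟨|Real.log K|, fun y => by
        by_cases hy : dec y = w <;> simp [Set.indicator, hy]⟩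
    have hexp : (fun y => Real.exp ({y | dec y = w}.indicator (fun _ => Real.log K) y))
        = fun y => 1 + {y | dec y = w}.indicator (fun _ => (K : ℝ) - 1) y := by
      funext y
      by_cases hy : dec y = w <;> simp [Set.indicator, hy, Real.exp_log (by linarith : (0:ℝ) < K)]
    rw [hexp, integral_indicator_const _ (hset w), integral_add (integrable_const _)
      ((integrable_const _).indicator (hset w)), integral_indicator_const _ (hset w)] at h1
    have hQ : 0 ≤ Q.real {y | dec y = w} := measureReal_nonneg
    have h2 := Real.log_le_sub_one_of_pos
      (x := 1 + Q.real {y | dec y = w} * ((K : ℝ) - 1)) (by nlinarith)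
    simp at h1
    nlinarith
  have hQ1 : ∑ w, Q.real {y | dec y = w} = 1 := by
    have h1 := sum_measureReal_preimage_singleton (μ := Q) (f := dec) Finset.univ
      (fun w _ => hset w)
    simpa [Set.preimage] using h1
  rw [Finset.sum_mul]
  calc _ ≤ ∑ w, (D w + K * Q.real {y | dec y = w}) := Finset.sum_le_sum fun w _ => hstep w
    _ = _ := by rw [Finset.sum_add_distrib, ← Finset.mul_sum, hQ1, mul_one]

variable {r : Resistances} {σ : ℝ} {F : PMF unitInterval} {Q : unitInterval → Measure ℝ}
  [∀ ε, IsProbabilityMeasure (Q ε)] {D : Bool → unitInterval → ℝ} {C : Bool → ℝ}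

/-- The reference law has the same mixing weights `F`, as if `ε` were revealed to the decoder; this
is why the average of capacities appears in the upper bound. -/
theorem relEntropyLE_blockLaw (hC : ∀ b, HasSum (fun ε => (F ε).toReal * D b ε) (C b))
    (h : ∀ ε b, RelEntropyLE (esChannel r σ ε b) (Q ε) (D b ε)) {M : ℕ} (x : Fin M → Bool) :
    RelEntropyLE (blockLaw r σ F x)
      (Measure.sum fun ε => F ε • Measure.pi fun _ : Fin M => Q ε) (∑ j, C (x j)) := by
  refine RelEntropyLE.pmf_sum F (D := fun ε => ∑ j, D (x j) ε) ?_
    fun ε => RelEntropyLE.pi fun j => h ε (x j)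
  simp_rw [Finset.mul_sum]
  exact hasSum_sum fun j _ => hC (x j)

theorem BlockCode.errorProb_eq {T M : ℕ} (c : BlockCode T M) :
    c.errorProb r σ F
      = 1 - (∑ w, (blockVaryingLaw r σ F (c.enc w)).real {y | c.dec y = w}) / c.K := by
  have hK : (c.K : ℝ) ≠ 0 := by exact_mod_cast c.K_pos.ne'
  have h : ∀ w, (blockVaryingLaw r σ F (c.enc w)).real {y | c.dec y ≠ w}
      = 1 - (blockVaryingLaw r σ F (c.enc w)).real {y | c.dec y = w} := fun w =>
    probReal_compl_eq_one_sub (s := {y | c.dec y = w}) (c.measurable_dec (measurableSet_singleton w))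
  rw [BlockCode.errorProb, Finset.sum_congr rfl fun w _ => h w, Finset.sum_sub_distrib]
  simp
  field_simp

/-- A function of a bit is affine in the bit, so only the input distribution of the code enters. -/
theorem BlockCode.sum_symbol_eq {T M : ℕ} (hT : 0 < T) (hM : 0 < M) (c : BlockCode T M)
    (C : Bool → ℝ) :
    ∑ w, ∑ t, ∑ j, C (c.enc w t j)
      = c.K * (M * T) * ((1 - c.inputProb) * C false + c.inputProb * C true) := by
  have hK : (0 : ℝ) < c.K := by exact_mod_cast c.K_pos
  have hT' : (0 : ℝ) < T := by exact_mod_cast hT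
  have hM' : (0 : ℝ) < M := by exact_mod_cast hM
  have h : ∀ b : Bool, C b = C false + (if b = true then (1 : ℝ) else 0) * (C true - C false) := by
    intro b; cases b <;> simp
  have h1 : c.inputProb * (c.K * (M * T))
      = ∑ w, ∑ t, ∑ j, if c.enc w t j = true then (1 : ℝ) else 0 := by
    rw [BlockCode.inputProb, div_mul_cancel₀ _ (by positivity)]
  simp_rw [fun w t j => h (c.enc w t j), Finset.sum_add_distrib, ← Finset.sum_mul]
  rw [← h1]
  simp
  ring

theorem BlockCode.correct_mul_rate_le {T M : ℕ} (hT : 0 < T) (hM : 0 < M)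
    (hC : ∀ b, HasSum (fun ε => (F ε).toReal * D b ε) (C b))
    (h : ∀ ε b, RelEntropyLE (esChannel r σ ε b) (Q ε) (D b ε)) (c : BlockCode T M) :
    (1 - c.errorProb r σ F) * (c.rate * Real.log 2)
      ≤ (1 - c.inputProb) * C false + c.inputProb * C true + 1 / (M * T) := by
  have hK : (0 : ℝ) < c.K := by exact_mod_cast c.K_pos
  have hT' : (0 : ℝ) < T := by exact_mod_cast hT
  have hM' : (0 : ℝ) < M := by exact_mod_cast hM
  have hQ := isProbabilityMeasure_sum_pmf_smul F fun ε => Measure.pi fun _ : Fin M => Q ε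
  have h1 := sum_correct_mul_log_le c.K_pos (P := fun w => blockVaryingLaw r σ F (c.enc w))
    (fun w => RelEntropyLE.pi fun t => relEntropyLE_blockLaw hC h (c.enc w t)) c.measurable_dec
  rw [c.sum_symbol_eq hT hM] at h1
  have hrate : c.rate * Real.log 2 = Real.log c.K / (M * T) := by
    have h2 : Real.log 2 ≠ 0 := (Real.log_pos (by norm_num)).ne'
    rw [BlockCode.rate, Real.logb]
    field_simp
  rw [c.errorProb_eq, hrate, sub_sub_cancel, div_mul_div_comm, div_le_iff₀ (by positivity)]
  refine h1.trans_eq ?_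
  field_simp

theorem BlockCode.rate_nonneg {T M : ℕ} (c : BlockCode T M) : 0 ≤ c.rate :=
  div_nonneg (Real.logb_nonneg (by norm_num) (by exact_mod_cast c.K_pos)) (by positivity)

theorem IsAchievableRate.mul_log_two_le {q : unitInterval} {M : ℕ} (hM : 0 < M) {R : ℝ}
    (hR : IsAchievableRate r σ F q M R)
    (hC : ∀ b, HasSum (fun ε => (F ε).toReal * D b ε) (C b))
    (h : ∀ ε b, RelEntropyLE (esChannel r σ ε b) (Q ε) (D b ε)) :
    R * Real.log 2 ≤ (1 - q) * C false + q * C true := by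
  have hC0 : ∀ b, 0 ≤ C b := fun b =>
    (hC b).nonneg fun ε => mul_nonneg ENNReal.toReal_nonneg (h ε b).nonneg
  have hlog : 0 < Real.log 2 := Real.log_pos (by norm_num)
  have key : ∀ δ ∈ Set.Ioo (0 : ℝ) 1, (1 - δ) * ((R - δ) * Real.log 2)
      ≤ (1 - q) * C false + q * C true + δ * (C false + C true + 1) := by
    rintro δ ⟨hδ, hδ1⟩
    have hM' : (1 : ℝ) ≤ M := by exact_mod_cast hM
    -- Taking `T ≥ 1 / δ` makes the additive loss `1 / (M * T)` of the converse at most `δ`.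
    obtain ⟨T, ⟨c, hc, he, hq⟩, hT⟩ := ((hR δ hδ).and
      ((tendsto_natCast_atTop_atTop (R := ℝ)).eventually_ge_atTop (1 / δ))).exists
    have hT' : (0 : ℝ) < T := (by positivity : 0 < 1 / δ).trans_le hT
    have h1 := c.correct_mul_rate_le (by exact_mod_cast hT') hM hC h
    have h2 : 1 / ((M : ℝ) * T) ≤ δ := by
      rw [div_le_iff₀ (by positivity)]
      rw [div_le_iff₀ hδ] at hT
      nlinarith
    have h3 : (1 - δ) * ((R - δ) * Real.log 2)
        ≤ (1 - c.errorProb r σ F) * (c.rate * Real.log 2) :=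
      calc _ ≤ (1 - δ) * (c.rate * Real.log 2) := by gcongr
        _ ≤ _ := by
          have := mul_nonneg c.rate_nonneg hlog.le
          gcongr
    rw [abs_le] at hq
    nlinarith [hC0 false, hC0 true]
  have hl : Tendsto (fun δ : ℝ => (1 - δ) * ((R - δ) * Real.log 2)) (nhdsWithin 0 (Set.Ioi 0))
      (nhds ((1 - 0) * ((R - 0) * Real.log 2))) :=
    (Continuous.tendsto (by fun_prop) 0).mono_left nhdsWithin_le_nhds
  have hr : Tendsto (fun δ : ℝ => (1 - q) * C false + q * C true + δ * (C false + C true + 1))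
      (nhdsWithin 0 (Set.Ioi 0))
      (nhds ((1 - q) * C false + q * C true + 0 * (C false + C true + 1))) :=
    (Continuous.tendsto (by fun_prop) 0).mono_left nhdsWithin_le_nhds
  have := le_of_tendsto_of_tendsto hl hr
    (by filter_upwards [Ioo_mem_nhdsGT (zero_lt_one' ℝ)] with δ hδ using key δ hδ)
  simpa using this

end Converse

/-! ### Likelihood ratios and mutual information -/

section Likelihood

variable {α : Type*} [MeasurableSpace α]

/-- `ρ b` is a version of the density of `κ b` with respect to the output law of `κ` under the
input law Bernoulli(`q`), normalised so that the input average of `ρ` is `1` everywhere. -/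
structure IsLikelihood (κ : Kernel Bool α) (q : unitInterval) (ρ : Bool → α → ℝ) : Prop where
  measurable : ∀ b, Measurable (ρ b)
  nonneg : ∀ b y, 0 ≤ ρ b y
  average : ∀ y, q * ρ true y + (1 - q) * ρ false y = 1
  eq_withDensity : ∀ b, κ b = ((bernoulliMeasure true false q).bind κ).withDensity
    fun y => ENNReal.ofReal (ρ b y)

theorem bernoulliMeasure_bind (κ : Kernel Bool α) (q : unitInterval) :
    (bernoulliMeasure true false q).bind κ
      = unitInterval.toNNReal q • κ true
        + unitInterval.toNNReal (unitInterval.symm q) • κ false := by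
  ext s hs
  rw [Measure.bind_apply hs κ.aemeasurable, bernoulliMeasure_def, lintegral_add_measure,
    lintegral_smul_measure, lintegral_smul_measure, lintegral_dirac, lintegral_dirac]
  rfl

theorem eq_withDensity_div_of_smul_eq {P Q : Measure α} {a : NNReal} (ha : 0 < a) {g : α → ℝ}
    (hg : Measurable g) (h : a • P = Q.withDensity fun y => ENNReal.ofReal (g y)) :
    P = Q.withDensity fun y => ENNReal.ofReal (g y / a) := by
  have h1 : (fun y => ENNReal.ofReal (g y / a))
      = (a : ENNReal)⁻¹ • fun y => ENNReal.ofReal (g y) := by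
    funext y
    rw [Pi.smul_apply, smul_eq_mul, ENNReal.ofReal_div_of_pos (by exact_mod_cast ha), mul_comm,
      div_eq_mul_inv, ENNReal.ofReal_coe_nnreal]
  have ha' : (a : ENNReal) ≠ 0 := by exact_mod_cast ha.ne'
  rw [h1, withDensity_smul _ (by fun_prop), ← h, show a • P = (a : ENNReal) • P from rfl,
    smul_smul, ENNReal.inv_mul_cancel ha' ENNReal.coe_ne_top, one_smul]

/-- Radon–Nikodym applied to `q • κ true ≤ Q`. Truncating the density at `1` changes it on a null
set only and makes both `g` and `1 - g` nonnegative at every point, so the average is `1` everywhere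
and not just almost everywhere. -/
theorem exists_isLikelihood (κ : Kernel Bool α) [IsMarkovKernel κ] {q : unitInterval}
    (h0 : 0 < q) (h1 : q < 1) : ∃ ρ, IsLikelihood κ q ρ := by
  set Q := (bernoulliMeasure true false q).bind κ with hQ
  have hQm : Q = unitInterval.toNNReal q • κ true
      + unitInterval.toNNReal (unitInterval.symm q) • κ false := bernoulliMeasure_bind κ q
  have hq0 : (0 : ℝ) < q := h0
  have hq1 : (0 : ℝ) < 1 - q := sub_pos.2 h1
  have ha : 0 < unitInterval.toNNReal q := h0
  have hb : 0 < unitInterval.toNNReal (unitInterval.symm q) := by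
    exact_mod_cast (show (0 : ℝ) < unitInterval.toNNReal (unitInterval.symm q) by simpa using hq1)
  set N := unitInterval.toNNReal q • κ true with hN
  have hle : N ≤ Q := by rw [hQm]; exact Measure.le_add_right le_rfl
  set g : α → ℝ := fun y => min (N.rnDeriv Q y).toReal 1 with hg
  have hgm : Measurable g := (Measure.measurable_rnDeriv _ _).ennreal_toReal.min measurable_const
  have hg0 : ∀ y, 0 ≤ g y := fun y => le_min ENNReal.toReal_nonneg zero_le_one
  have hg1 : ∀ y, g y ≤ 1 := fun y => min_le_right _ _
  have hNg : N = Q.withDensity fun y => ENNReal.ofReal (g y) := by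
    conv_lhs => rw [← Measure.withDensity_rnDeriv_eq N Q (Measure.absolutelyContinuous_of_le hle)]
    refine withDensity_congr_ae ?_
    filter_upwards [Measure.rnDeriv_le_one_of_le hle] with y hy
    have hy1 : N.rnDeriv Q y ≤ 1 := hy
    have htop : N.rnDeriv Q y ≠ ⊤ := (hy1.trans_lt ENNReal.one_lt_top).ne
    have hle1 : (N.rnDeriv Q y).toReal ≤ 1 := by
      simpa using ENNReal.toReal_mono ENNReal.one_ne_top hy1
    rw [hg]
    simp only [min_eq_left hle1, ENNReal.ofReal_toReal htop]
  have hfg : unitInterval.toNNReal (unitInterval.symm q) • κ false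
      = Q.withDensity fun y => ENNReal.ofReal (1 - g y) := by
    have hsum : Q = N + Q.withDensity fun y => ENNReal.ofReal (1 - g y) := by
      conv_rhs => rw [hNg, ← withDensity_add_left (by fun_prop)]
      have : ((fun y => ENNReal.ofReal (g y)) + fun y => ENNReal.ofReal (1 - g y)) = 1 := by
        funext y
        simp [← ENNReal.ofReal_add (hg0 y) (sub_nonneg.2 (hg1 y))]
      rw [this, withDensity_one]
    have h3 := hQm.symm.trans hsum
    rwa [Measure.add_right_inj] at h3
  refine ⟨fun b y => bif b then g y / q else (1 - g y) / (1 - q), ?_, ?_, ?_, ?_⟩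
  · rintro (_ | _)
    · exact (measurable_const.sub hgm).div_const _
    · exact hgm.div_const _
  · rintro (_ | _) y
    · exact div_nonneg (sub_nonneg.2 (hg1 y)) hq1.le
    · exact div_nonneg (hg0 y) hq0.le
  · intro y
    simp only [cond_true, cond_false]
    field_simp
    ring
  · rintro (_ | _)
    · have := eq_withDensity_div_of_smul_eq hb (by fun_prop) hfg
      simpa using this
    · have := eq_withDensity_div_of_smul_eq ha hgm hNg
      simpa using this

/-- Makes log-likelihoods square integrable: under `κ b` the second moment of `log ρ` is the
integral of `ρ * log ρ ^ 2` against the output law, and `ρ` is bounded. With `t = u ^ 2` it follows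
from `|u * log u| ≤ 1 + u ^ 2`. -/
theorem mul_log_sq_le {t : ℝ} (ht : 0 ≤ t) : t * Real.log t ^ 2 ≤ 4 * (1 + t) ^ 2 := by
  rcases ht.eq_or_lt with h | h
  · subst h; simp
  obtain ⟨u, hu, rfl⟩ : ∃ u, 0 < u ∧ t = u ^ 2 :=
    ⟨Real.sqrt t, Real.sqrt_pos.2 h, (Real.sq_sqrt ht).symm⟩
  have h1 := Real.log_le_sub_one_of_pos hu
  have h2 := Real.log_le_sub_one_of_pos (inv_pos.2 hu)
  rw [Real.log_inv] at h2
  have h3 : u * Real.log u ≤ 1 + u ^ 2 := by nlinarith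
  have h4 : -(1 + u ^ 2) ≤ u * Real.log u := by
    have := mul_le_mul_of_nonneg_left h2 hu.le
    rw [mul_sub, mul_inv_cancel₀ hu.ne'] at this
    nlinarith
  rw [Real.log_pow]
  have := sq_le_sq' h4 h3
  push_cast
  nlinarith

namespace IsLikelihood

variable {κ : Kernel Bool α} {q : unitInterval} {ρ : Bool → α → ℝ}

theorem le_one_div (h : IsLikelihood κ q ρ) (h0 : 0 < q) (h1 : q < 1) (b : Bool) (y : α) :
    ρ b y ≤ 1 / (bif b then (q : ℝ) else 1 - q) := by
  have hq0 : (0 : ℝ) < q := h0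
  have hq1 : (0 : ℝ) < 1 - q := sub_pos.2 h1
  have ht := h.nonneg true y
  have hf := h.nonneg false y
  have ha := h.average y
  cases b
  · rw [cond_false, le_div_iff₀ hq1]; nlinarith
  · rw [cond_true, le_div_iff₀ hq0]; nlinarith

theorem ae_pos (h : IsLikelihood κ q ρ) (b : Bool) : ∀ᵐ y ∂κ b, 0 < ρ b y := by
  rw [h.eq_withDensity b]
  exact ae_pos_withDensity (h.measurable b)

variable [IsMarkovKernel κ]

theorem memLp_log (h : IsLikelihood κ q ρ) (h0 : 0 < q) (h1 : q < 1) (b : Bool) :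
    MemLp (fun y => Real.log (ρ b y)) 2 (κ b) := by
  have hm := h.measurable b
  rw [memLp_two_iff_integrable_sq hm.log.aestronglyMeasurable, h.eq_withDensity b,
    integrable_ofReal_withDensity_iff hm (h.nonneg b)]
  set B := 1 / (bif b then (q : ℝ) else 1 - q)
  refine integrable_of_abs_le (B := 4 * (1 + B) ^ 2) (by fun_prop) fun y => ?_
  rw [abs_of_nonneg (mul_nonneg (h.nonneg b y) (sq_nonneg _))]
  refine (mul_log_sq_le (h.nonneg b y)).trans ?_
  have := h.nonneg b y
  have := h.le_one_div h0 h1 b y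
  gcongr

theorem integrable_log (h : IsLikelihood κ q ρ) (h0 : 0 < q) (h1 : q < 1) (b : Bool) :
    Integrable (fun y => Real.log (ρ b y)) (κ b) :=
  (h.memLp_log h0 h1 b).integrable (by norm_num)

theorem relEntropyLE (h : IsLikelihood κ q ρ) (h0 : 0 < q) (h1 : q < 1) (b : Bool) :
    RelEntropyLE (κ b) ((bernoulliMeasure true false q).bind κ)
      (∫ y, Real.log (ρ b y) ∂κ b) :=
  RelEntropyLE.of_withDensity (h.measurable b) (h.nonneg b) (h.eq_withDensity b)
    (h.integrable_log h0 h1 b)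

theorem integral_log_le (h : IsLikelihood κ q ρ) (h0 : 0 < q) (h1 : q < 1) (b : Bool) :
    ∫ y, Real.log (ρ b y) ∂κ b ≤ Real.log (1 / (bif b then (q : ℝ) else 1 - q)) := by
  have := integral_mono_ae (h.integrable_log h0 h1 b)
    (integrable_const (Real.log (1 / (bif b then (q : ℝ) else 1 - q)))) (by
      filter_upwards [h.ae_pos b] with y hy
      exact Real.log_le_log hy (h.le_one_div h0 h1 b y))
  simpa using this

theorem compProd_eq_withDensity (h : IsLikelihood κ q ρ) :
    (bernoulliMeasure true false q).compProd κ
      = ((bernoulliMeasure true false q).prod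
          ((bernoulliMeasure true false q).bind κ)).withDensity
        fun z => ENNReal.ofReal (ρ z.1 z.2) := by
  have hm : Measurable fun z : Bool × α => ρ z.1 z.2 :=
    measurable_from_prod_countable_right h.measurable
  ext s hs
  rw [Measure.compProd_apply hs, withDensity_apply _ hs, ← lintegral_indicator hs,
    lintegral_prod _ ((Measurable.indicator (by fun_prop) hs).aemeasurable)]
  refine lintegral_congr fun b => ?_
  rw [h.eq_withDensity b, withDensity_apply _ (measurable_prodMk_left hs),
    ← lintegral_indicator (measurable_prodMk_left hs)]
  rfl

theorem mutualInfo_mul_log_two (h : IsLikelihood κ q ρ) (h0 : 0 < q) (h1 : q < 1) :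
    mutualInfo (bernoulliMeasure true false q) κ * Real.log 2
      = q * ∫ y, Real.log (ρ true y) ∂κ true
        + (1 - q) * ∫ y, Real.log (ρ false y) ∂κ false := by
  have hm : Measurable fun z : Bool × α => ρ z.1 z.2 :=
    measurable_from_prod_countable_right h.measurable
  set μ := bernoulliMeasure true false q
  have hwd := h.compProd_eq_withDensity
  have hac : μ.compProd κ ≪ μ.prod (μ.bind κ) := by
    rw [hwd]; exact withDensity_absolutelyContinuous _ _
  have hllr : llr (μ.compProd κ) (μ.prod (μ.bind κ))
      =ᵐ[μ.compProd κ] fun z => Real.log (ρ z.1 z.2) := by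
    refine hac.ae_le ?_
    have hd := Measure.rnDeriv_withDensity (μ.prod (μ.bind κ))
      (f := fun z => ENNReal.ofReal (ρ z.1 z.2)) (by fun_prop)
    rw [← hwd] at hd
    filter_upwards [hd] with z hz
    rw [llr, hz, ENNReal.toReal_ofReal (h.nonneg _ _)]
  have hint : Integrable (fun z : Bool × α => Real.log (ρ z.1 z.2)) (μ.compProd κ) := by
    rw [Measure.integrable_compProd_iff hm.log.aestronglyMeasurable]
    exact ⟨ae_of_all _ fun b => h.integrable_log h0 h1 b, integrable_bernoulliMeasure _ _ _ _⟩
  rw [mutualInfo, div_mul_cancel₀ _ (Real.log_pos (by norm_num)).ne',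
    InformationTheory.toReal_klDiv_of_measure_eq hac (by simp), integral_congr_ae hllr,
    Measure.integral_compProd hint, integral_bernoulliMeasure]
  simp

end IsLikelihood

theorem mutualInfo_nonneg {β : Type*} [MeasurableSpace β] (μ : Measure α) (κ : Kernel α β) :
    0 ≤ mutualInfo μ κ :=
  div_nonneg ENNReal.toReal_nonneg (Real.log_nonneg (by norm_num))

theorem mutualInfo_dirac {β : Type*} [MeasurableSpace β] [MeasurableSingletonClass α]
    (a : α) (κ : Kernel α β) [IsMarkovKernel κ] : mutualInfo (Measure.dirac a) κ = 0 := by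
  have h : (Measure.dirac a).compProd κ = (Measure.dirac a).prod ((Measure.dirac a).bind κ) := by
    rw [Measure.dirac_bind κ.measurable, Measure.dirac_prod]
    ext s hs
    rw [Measure.dirac_compProd_apply hs, Measure.map_apply measurable_prodMk_left hs]
  simp [mutualInfo, h, Measure.dirac_bind κ.measurable]

end Likelihood

/-! ### A greedy codebook with a threshold decoder -/

section Codebook

theorem exists_mem_le_div_sum {X : Type*} {A : Finset X} {p f : X → ℝ} (hp : ∀ x, 0 ≤ p x)
    (hA : 0 < ∑ x ∈ A, p x) {e : ℝ} (h : ∑ x ∈ A, p x * f x ≤ e) :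
    ∃ x ∈ A, f x ≤ e / ∑ x ∈ A, p x := by
  have hne : A.Nonempty := by
    rw [Finset.nonempty_iff_ne_empty]
    rintro rfl
    simp at hA
  obtain ⟨z, hz, hmin⟩ := A.exists_min_image f hne
  refine ⟨z, hz, ?_⟩
  rw [le_div_iff₀ hA, Finset.mul_sum]
  refine le_trans (Finset.sum_le_sum fun x hx => ?_) h
  rw [mul_comm]
  exact mul_le_mul_of_nonneg_left (hmin x hx) (hp x)

/-- Greedy choice of codewords: each new codeword is confused little with the earlier ones. -/
theorem exists_codewords {X : Type*} {A : Finset X} {p : X → ℝ} (hp : ∀ x, 0 ≤ p x)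
    (hA : 0 < ∑ x ∈ A, p x) {b : X → X → ℝ} {e : ℝ} (hb : ∀ x, ∑ z ∈ A, p z * b x z ≤ e)
    (n : ℕ) :
    ∃ x : Fin n → X, (∀ k, x k ∈ A) ∧
      ∀ k, ∑ i, (if i < k then b (x i) (x k) else 0) ≤ k * (e / ∑ x ∈ A, p x) := by
  induction n with
  | zero => exact ⟨Fin.elim0, fun k => k.elim0, fun k => k.elim0⟩
  | succ n ih =>
    obtain ⟨x, hxA, hx⟩ := ih
    -- The total confusion with the `n` earlier codewords has weighted sum at most `n * e` over `A`,
    -- so some `z` in `A` does no worse than the average.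
    obtain ⟨z, hzA, hz⟩ := exists_mem_le_div_sum (f := fun z => ∑ i, b (x i) z) hp hA
      (e := n * e) (by
        simp_rw [Finset.mul_sum]
        rw [Finset.sum_comm]
        calc _ ≤ ∑ _i : Fin n, e := Finset.sum_le_sum fun i _ => hb (x i)
          _ = _ := by simp)
    refine ⟨Fin.snoc x z, fun k => ?_, fun k => ?_⟩
    · refine Fin.lastCases ?_ (fun j => ?_) k
      · simpa using hzA
      · simpa using hxA j
    · refine Fin.lastCases ?_ (fun j => ?_) k
      · simpa [Fin.sum_univ_castSucc, Fin.castSucc_lt_last, mul_div_assoc] using hz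
      · have : ¬ Fin.last n < j.castSucc := not_lt.2 (Fin.le_last _)
        simpa [Fin.sum_univ_castSucc, this] using hx j

/-- Decoding to the last codeword whose score exceeds the threshold. -/
theorem exists_threshold_decoder {Y : Type*} [MeasurableSpace Y] {K : ℕ} (hK : 0 < K)
    {S : Fin K → Y → ℝ} (hS : ∀ w, Measurable (S w)) (θ : ℝ) :
    ∃ dec : Y → Fin K, Measurable dec ∧
      ∀ y w, dec y ≠ w → S w y ≤ θ ∨ ∃ w', w < w' ∧ θ < S w' y := by
  classical
  have := Fin.pos_iff_nonempty.1 hK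
  -- The value when no score passes is immaterial: the sent codeword is then itself below the
  -- threshold.
  let sel : (Fin K → Bool) → Fin K := fun v =>
    if h : (Finset.univ.filter fun w => v w = true).Nonempty then Finset.max' _ h
    else Classical.arbitrary _
  refine ⟨fun y => sel fun w => decide (θ < S w y), ?_, ?_⟩
  · refine (measurable_of_countable sel).comp (measurable_pi_lambda _ fun w => ?_)
    exact measurable_to_bool (by simpa [Set.preimage] using measurableSet_lt measurable_const (hS w))
  · intro y w hw
    by_contra! hcon
    obtain ⟨h1, h2⟩ := hcon
    have hmem : w ∈ Finset.univ.filter fun w => decide (θ < S w y) = true := by simpa using h1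
    apply hw
    simp only [sel]
    rw [dif_pos ⟨w, hmem⟩]
    refine le_antisymm (Finset.max'_le _ _ _ fun v hv => ?_) (Finset.le_max' _ _ hmem)
    by_contra! hlt
    exact absurd (h2 v hlt) (not_le.2 (by simpa using hv))

/-- The bound `hS1` holds for each `y`, so by Markov's inequality the `p`-weight of the codewords in
`A` scoring above `θ` is at most `1 / θ` at each `y`, hence on average under any output law. The
score therefore need not be the likelihood ratio of `P`. -/
theorem exists_codebook {X Y : Type*} [MeasurableSpace Y] {A : Finset X} {p : X → ℝ}
    (hp : ∀ x, 0 ≤ p x) (hA : 0 < ∑ x ∈ A, p x) {P : X → Measure Y}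
    [∀ x, IsProbabilityMeasure (P x)] {S : X → Y → ℝ} (hS : ∀ x, Measurable (S x))
    (hS0 : ∀ x y, 0 ≤ S x y) (hS1 : ∀ y, ∑ x ∈ A, p x * S x y ≤ 1) {θ η : ℝ} (hθ : 0 < θ)
    (hη : ∀ x ∈ A, (P x).real {y | S x y ≤ θ} ≤ η) {K : ℕ} (hK : 0 < K) :
    ∃ enc : Fin K → X, ∃ dec : Y → Fin K, (∀ w, enc w ∈ A) ∧ Measurable dec ∧
      ∑ w, (P (enc w)).real {y | dec y ≠ w}
        ≤ K * (η + (K - 1) * (1 / θ / ∑ x ∈ A, p x)) := by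
  have hms : ∀ z, MeasurableSet {y | θ < S z y} := fun z => measurableSet_lt measurable_const (hS z)
  obtain ⟨enc, hencA, henc⟩ := exists_codewords hp hA
    (b := fun x z => (P x).real {y | θ < S z y}) (e := 1 / θ) (fun x => by
      have hi : ∀ z ∈ A, Integrable (fun y => p z * {y | θ < S z y}.indicator 1 y) (P x) :=
        fun z _ => ((integrable_const (1 : ℝ)).indicator (hms z)).const_mul _
      calc ∑ z ∈ A, p z * (P x).real {y | θ < S z y}
          = ∫ y, ∑ z ∈ A, p z * {y | θ < S z y}.indicator 1 y ∂P x := by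
            rw [integral_finsetSum _ hi]
            refine Finset.sum_congr rfl fun z _ => ?_
            rw [integral_const_mul, integral_indicator_one (hms z)]
        _ ≤ ∫ _, 1 / θ ∂P x := by
            refine integral_mono (integrable_finsetSum _ hi) (integrable_const _) fun y => ?_
            rw [le_div_iff₀ hθ, Finset.sum_mul]
            refine (Finset.sum_le_sum fun z _ => ?_).trans (hS1 y)
            rw [mul_assoc]
            refine mul_le_mul_of_nonneg_left ?_ (hp z)
            by_cases h : θ < S z y
            · simpa [Set.indicator, h] using h.le
            · simpa [Set.indicator, h] using hS0 z y
        _ = 1 / θ := by simp) K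
  obtain ⟨dec, hdec, herr⟩ := exists_threshold_decoder hK (fun w => hS (enc w)) θ
  refine ⟨enc, dec, hencA, hdec, ?_⟩
  have hc : 0 ≤ 1 / θ / ∑ x ∈ A, p x := by positivity
  have hw : ∀ w, (P (enc w)).real {y | dec y ≠ w}
      ≤ η + ∑ w', if w < w' then (P (enc w)).real {y | θ < S (enc w') y} else 0 := fun w => by
    calc _ ≤ (P (enc w)).real ({y | S (enc w) y ≤ θ} ∪
          ⋃ w' ∈ Finset.univ.filter (w < ·), {y | θ < S (enc w') y}) := by
            refine measureReal_mono fun y hy => ?_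
            simpa using herr y w hy
      _ ≤ _ := (measureReal_union_le _ _).trans (add_le_add (hη _ (hencA w))
            ((measureReal_biUnion_finset_le _ _).trans_eq (Finset.sum_filter _ _)))
  calc _ ≤ ∑ w, (η + ∑ w', if w < w' then (P (enc w)).real {y | θ < S (enc w') y} else 0) :=
        Finset.sum_le_sum fun w _ => hw w
    -- Each confusion of a pair is charged to the later codeword, for which the greedy choice
    -- controls the sum over the earlier ones.
    _ = ∑ w', (η + ∑ w, if w < w' then (P (enc w)).real {y | θ < S (enc w') y} else 0) := by
        rw [Finset.sum_add_distrib, Finset.sum_add_distrib, Finset.sum_comm]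
    _ ≤ ∑ _w' : Fin K, (η + ((K : ℝ) - 1) * (1 / θ / ∑ x ∈ A, p x)) := by
        refine Finset.sum_le_sum fun w' _ => add_le_add le_rfl ((henc w').trans ?_)
        refine mul_le_mul_of_nonneg_right ?_ hc
        have : ((w' : ℕ) : ℝ) + 1 ≤ K := by exact_mod_cast w'.2
        linarith
    _ = _ := by simp [mul_add]

end Codebook

/-- Chebyshev's inequality for a sum of independent coordinates. -/
theorem pi_real_le_abs_sum_sub_le {ι : Type*} [Fintype ι] {Ω : ι → Type*}
    [∀ i, MeasurableSpace (Ω i)] {μ : ∀ i, Measure (Ω i)} [∀ i, IsProbabilityMeasure (μ i)]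
    {X : ∀ i, Ω i → ℝ} (hX : ∀ i, MemLp (X i) 2 (μ i)) {V : ℝ} (hV : ∀ i, Var[X i; μ i] ≤ V)
    {c : ℝ} (hc : 0 < c) :
    (Measure.pi μ).real {ω | c ≤ |∑ i, X i (ω i) - ∑ i, ∫ x, X i x ∂μ i|}
      ≤ Fintype.card ι * V / c ^ 2 := by
  have hmp := fun i => measurePreserving_eval μ i
  have hXi : ∀ i, MemLp (fun ω : ∀ i, Ω i => X i (ω i)) 2 (Measure.pi μ) := fun i =>
    (hX i).comp_measurePreserving (hmp i)
  have hmean : ∫ ω, (∑ i, fun ω : ∀ i, Ω i => X i (ω i)) ω ∂Measure.pi μ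
      = ∑ i, ∫ x, X i x ∂μ i := by
    simp only [Finset.sum_apply]
    rw [integral_finsetSum _ fun i _ => (hXi i).integrable (by norm_num)]
    refine Finset.sum_congr rfl fun i _ => ?_
    conv_rhs => rw [← (hmp i).map_eq]
    rw [integral_map (hmp i).measurable.aemeasurable (by rw [(hmp i).map_eq]; exact (hX i).1)]
  have h := meas_ge_le_variance_div_sq (memLp_finsetSum' Finset.univ fun i _ => hXi i) hc
  rw [variance_sum_pi hX, hmean] at h
  simp only [Finset.sum_apply] at h
  have h2 := ENNReal.toReal_mono ENNReal.ofReal_ne_top h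
  rw [ENNReal.toReal_ofReal (div_nonneg (Finset.sum_nonneg fun i _ => variance_nonneg _ _)
    (sq_nonneg _))] at h2
  refine h2.trans ?_
  gcongr
  calc _ ≤ ∑ _i : ι, V := Finset.sum_le_sum fun i _ => hV i
    _ = _ := by simp

/-! ### One-symbol marginals: the channel with the mean parameter -/

section MeanChannel

variable {r : Resistances} {σ : ℝ} {F : PMF unitInterval}

theorem esChannel_false_apply (ε : unitInterval) (s : Set ℝ) :
    esChannel r σ ε false s
      = ENNReal.ofReal ε * Measure.conv (Measure.dirac r.R0') (gaussianReal 0 (Real.toNNReal (σ ^ 2))) s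
        + ENNReal.ofReal (1 - ε)
          * Measure.conv (Measure.dirac r.R0) (gaussianReal 0 (Real.toNNReal (σ ^ 2))) s := by
  have hs : ∀ (a : NNReal) (x : ℝ), Measure.conv (a • Measure.dirac x)
      (gaussianReal 0 (Real.toNNReal (σ ^ 2)))
      = a • Measure.conv (Measure.dirac x) (gaussianReal 0 (Real.toNNReal (σ ^ 2))) := fun a x => by
    rw [Measure.conv, Measure.prod_smul_left, Measure.map_smul, Measure.conv]
  have h : esChannel r σ ε false
      = Measure.conv (bernoulliMeasure r.R0' r.R0 ε) (gaussianReal 0 (Real.toNNReal (σ ^ 2))) := rfl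
  rw [h, bernoulliMeasure_def, Measure.add_conv, hs, hs, Measure.add_apply]
  have h1 : ENNReal.ofReal (ε : ℝ) = (unitInterval.toNNReal ε : ENNReal) := by
    rw [← ENNReal.ofReal_coe_nnreal]; rfl
  have h2 : ENNReal.ofReal (1 - ε : ℝ) = (unitInterval.toNNReal (unitInterval.symm ε) : ENNReal) := by
    rw [← ENNReal.ofReal_coe_nnreal]; rfl
  rw [h1, h2]
  rfl

theorem tsum_pmf_mul_ofReal {ι : Type*} {F : PMF ι} {g : ι → ℝ} (hg : ∀ i, 0 ≤ g i) {s : ℝ}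
    (h : HasSum (fun i => (F i).toReal * g i) s) :
    ∑' i, F i * ENNReal.ofReal (g i) = ENNReal.ofReal s := by
  rw [← h.tsum_eq, ENNReal.ofReal_tsum_of_nonneg
    (fun i => mul_nonneg ENNReal.toReal_nonneg (hg i)) h.summable]
  refine tsum_congr fun i => ?_
  rw [ENNReal.ofReal_mul ENNReal.toReal_nonneg, ENNReal.ofReal_toReal (F.apply_ne_top i)]

theorem hasSum_meanParam : HasSum (fun ε : unitInterval => (F ε).toReal * (ε : ℝ)) (meanParam F) :=
  (pmf_summable_toReal_mul F (B := 1) fun ε => by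
    rw [abs_of_nonneg ε.2.1]; exact ε.2.2).hasSum

/-- The channel with the mean parameter is the average of the channels. -/
theorem sum_esChannel (x : Bool) :
    (Measure.sum fun ε => F ε • esChannel r σ ε x) = esChannel r σ (meanParam F) x := by
  ext s hs
  rw [Measure.sum_apply _ hs]
  cases x
  · simp_rw [Measure.smul_apply, smul_eq_mul, esChannel_false_apply, mul_add, ← mul_assoc]
    rw [ENNReal.tsum_add, ENNReal.tsum_mul_right, ENNReal.tsum_mul_right,
      tsum_pmf_mul_ofReal (fun ε => ε.2.1) hasSum_meanParam,
      tsum_pmf_mul_ofReal (fun ε => sub_nonneg.2 ε.2.2)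
        (by simpa [mul_sub] using (pmf_hasSum_toReal F).sub hasSum_meanParam)]
  · have h : ∀ ε, esChannel r σ ε true s = esChannel r σ (meanParam F) true s := fun ε => rfl
    simp_rw [Measure.smul_apply, smul_eq_mul, h]
    rw [ENNReal.tsum_mul_right, F.tsum_coe, one_mul]

theorem measurePreserving_eval_blockLaw {M : ℕ} (x : Fin M → Bool) (j : Fin M) :
    MeasurePreserving (Function.eval j) (blockLaw r σ F x) (esChannel r σ (meanParam F) (x j)) := by
  refine ⟨measurable_pi_apply j, ?_⟩
  rw [blockLaw, Measure.map_sum (measurable_pi_apply j).aemeasurable, ← sum_esChannel]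
  congr 1
  funext ε
  rw [Measure.map_smul, (measurePreserving_eval (fun j => esChannel r σ ε (x j)) j).map_eq]

end MeanChannel

/-! ### Concentration of the input type and of the score -/

section Achievability

/-- The number of ones in the codeword `x`. -/
def onesCount {T M : ℕ} (x : Fin T → Fin M → Bool) : ℝ :=
  ∑ t, ∑ j, if x t j = true then (1 : ℝ) else 0

variable {r : Resistances} {σ : ℝ} {F : PMF unitInterval} {q : unitInterval}

theorem sum_symbol_eq_onesCount {T M : ℕ} (x : Fin T → Fin M → Bool) (C : Bool → ℝ) :
    ∑ t, ∑ j, C (x t j) = M * T * C false + onesCount x * (C true - C false) := by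
  have h : ∀ b : Bool, C b = C false + (if b = true then (1 : ℝ) else 0) * (C true - C false) := by
    intro b; cases b <;> simp
  simp_rw [fun t j => h (x t j), Finset.sum_add_distrib, ← Finset.sum_mul]
  rw [onesCount]
  simp
  ring

theorem BlockCode.abs_inputProb_sub_le {T M : ℕ} (hT : 0 < T) (hM : 0 < M) (c : BlockCode T M)
    {a δ : ℝ} (h : ∀ w, |onesCount (c.enc w) - M * T * a| ≤ M * T * δ) :
    |c.inputProb - a| ≤ δ := by
  have hK : (0 : ℝ) < c.K := by exact_mod_cast c.K_pos
  have hT' : (0 : ℝ) < T := by exact_mod_cast hT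
  have hM' : (0 : ℝ) < M := by exact_mod_cast hM
  have h1 : c.inputProb - a = (∑ w, (onesCount (c.enc w) - M * T * a)) / (c.K * (M * T)) := by
    rw [BlockCode.inputProb, Finset.sum_sub_distrib]
    simp only [onesCount]
    simp
    field_simp
  rw [h1, abs_div, abs_of_pos (by positivity : 0 < (c.K : ℝ) * (M * T)),
    div_le_iff₀ (by positivity)]
  refine (Finset.abs_sum_le_sum_abs _ _).trans ((Finset.sum_le_sum fun w _ => h w).trans_eq ?_)
  simp
  ring

/-- The law of a codeword with independent Bernoulli(`q`) symbols. -/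
noncomputable def codewordLaw (q : unitInterval) (T M : ℕ) : Measure (Fin T → Fin M → Bool) :=
  Measure.pi fun _ => Measure.pi fun _ => bernoulliMeasure true false q

instance (q : unitInterval) (T M : ℕ) : IsProbabilityMeasure (codewordLaw q T M) := by
  unfold codewordLaw; infer_instance

/-- The sum over codewords factorises into one sum over a bit for each position, and each of these
equals `1` by `hρ`. -/
theorem sum_codewordLaw_mul_prod {T M : ℕ} {ρ : Bool → ℝ → ℝ}
    (hρ : ∀ y, q * ρ true y + (1 - q) * ρ false y = 1) (y : Fin T → Fin M → ℝ) :
    ∑ x, (codewordLaw q T M).real {x} * ∏ t, ∏ j, ρ (x t j) (y t j) = 1 := by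
  have h : ∀ x, (codewordLaw q T M).real {x}
      = ∏ t, ∏ j, (bernoulliMeasure true false q).real {x t j} := fun x => by
    simp only [codewordLaw, measureReal_def, Measure.pi_singleton, ENNReal.toReal_prod]
  simp_rw [h, ← Finset.prod_mul_distrib]
  have h1 := Finset.prod_univ_sum (fun _ : Fin T => (Finset.univ : Finset (Fin M → Bool)))
    fun t u => ∏ j, (bernoulliMeasure true false q).real {u j} * ρ (u j) (y t j)
  rw [Fintype.piFinset_univ] at h1
  rw [← h1]
  refine Finset.prod_eq_one fun t _ => ?_
  have h2 := Finset.prod_univ_sum (fun _ : Fin M => (Finset.univ : Finset Bool))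
    fun j b => (bernoulliMeasure true false q).real {b} * ρ b (y t j)
  rw [Fintype.piFinset_univ] at h2
  rw [← h2]
  refine Finset.prod_eq_one fun j _ => ?_
  simpa using hρ (y t j)

theorem exists_codewordLaw_variance_bound (q : unitInterval) (M : ℕ) :
    ∃ V : ℝ, ∀ T : ℕ, ∀ c : ℝ, 0 < c →
      (codewordLaw q T M).real {x | c ≤ |onesCount x - M * T * q|} ≤ T * V / c ^ 2 := by
  set μ : Measure (Fin M → Bool) := Measure.pi fun _ => bernoulliMeasure true false q
  set X : (Fin M → Bool) → ℝ := fun u => ∑ j, if u j = true then (1 : ℝ) else 0 with hXdef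
  have hX : MemLp X 2 μ := by
    refine MemLp.of_bound (measurable_of_countable X).aestronglyMeasurable M (ae_of_all _ fun u => ?_)
    rw [Real.norm_of_nonneg (Finset.sum_nonneg fun j _ => by split_ifs <;> simp)]
    calc X u ≤ ∑ _j : Fin M, (1 : ℝ) := Finset.sum_le_sum fun j _ => by split_ifs <;> simp
      _ = M := by simp
  have hmean : ∫ u, X u ∂μ = M * q := by
    have hmp := fun j : Fin M => measurePreserving_eval (fun _ => bernoulliMeasure true false q) j
    have hj : ∀ j : Fin M, ∫ u, (if u j = true then (1 : ℝ) else 0) ∂μ = q := fun j => by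
      have := integral_map (μ := μ) (hmp j).measurable.aemeasurable
        (f := fun b : Bool => if b = true then (1 : ℝ) else 0)
        (measurable_of_countable _).aestronglyMeasurable
      rw [(hmp j).map_eq, integral_bernoulliMeasure] at this
      simpa using this.symm
    rw [hXdef, integral_finsetSum _ fun j _ => ?_]
    · simp [hj]
    · refine integrable_of_abs_le (B := 1) (measurable_of_countable _) fun u => ?_
      split_ifs <;> simp
  refine ⟨Var[X; μ], fun T c hc => ?_⟩
  have := pi_real_le_abs_sum_sub_le (fun _ : Fin T => hX) (fun _ => le_rfl) hc
  simp only [hmean, Finset.sum_const, Finset.card_univ, Fintype.card_fin, nsmul_eq_mul] at this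
  have he : (T : ℝ) * (M * q) = M * T * q := by ring
  rw [he] at this
  exact this

variable {ρ : Bool → ℝ → ℝ}

/-- Blocks are independent, so Chebyshev applies with whole blocks as coordinates; dependence inside
a block affects only the constant `V`, while the mean involves single symbols. There are finitely
many block inputs, so summing their variances gives one `V` for all `T` and `x`. -/
theorem exists_blockVaryingLaw_score_bound
    (h : IsLikelihood (esChannel r σ (meanParam F)) q ρ) (h0 : 0 < q) (h1 : q < 1) (M : ℕ) :
    ∃ V : ℝ, ∀ (T : ℕ) (x : Fin T → Fin M → Bool) (c θ : ℝ), 0 < c → 0 < θ →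
      Real.log θ ≤ ∑ t, ∑ j, ∫ y, Real.log (ρ (x t j) y) ∂esChannel r σ (meanParam F) (x t j) - c →
      (blockVaryingLaw r σ F x).real {y | ∏ t, ∏ j, ρ (x t j) (y t j) ≤ θ} ≤ T * V / c ^ 2 := by
  set Z : (Fin M → Bool) → (Fin M → ℝ) → ℝ := fun u v => ∑ j, Real.log (ρ (u j) (v j)) with hZdef
  have hmp := fun (u : Fin M → Bool) j => measurePreserving_eval_blockLaw (r := r) (σ := σ) (F := F) u j
  have hLj : ∀ (u : Fin M → Bool) (j : Fin M),
      MemLp (fun v : Fin M → ℝ => Real.log (ρ (u j) (v j))) 2 (blockLaw r σ F u) := fun u j =>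
    (h.memLp_log h0 h1 (u j)).comp_measurePreserving (hmp u j)
  have hZ : ∀ u, MemLp (Z u) 2 (blockLaw r σ F u) := fun u => memLp_finsetSum _ fun j _ => hLj u j
  have hmean : ∀ u, ∫ v, Z u v ∂blockLaw r σ F u
      = ∑ j, ∫ y, Real.log (ρ (u j) y) ∂esChannel r σ (meanParam F) (u j) := fun u => by
    rw [hZdef, integral_finsetSum _ fun j _ => (hLj u j).integrable (by norm_num)]
    refine Finset.sum_congr rfl fun j _ => ?_
    conv_rhs => rw [← (hmp u j).map_eq]
    rw [integral_map (hmp u j).measurable.aemeasurable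
      (h.measurable (u j)).log.aestronglyMeasurable]
  refine ⟨∑ u, Var[Z u; blockLaw r σ F u], fun T x c θ hc hθ hlog => ?_⟩
  have hcheb := pi_real_le_abs_sum_sub_le (μ := fun t => blockLaw r σ F (x t))
    (X := fun t => Z (x t)) (fun t => hZ (x t))
    (V := ∑ u, Var[Z u; blockLaw r σ F u])
    (fun t => Finset.single_le_sum (f := fun u => Var[Z u; blockLaw r σ F u])
      (fun u _ => variance_nonneg _ _) (Finset.mem_univ (x t))) hc
  rw [Fintype.card_fin] at hcheb
  refine le_trans ?_ hcheb
  -- The logarithm of the product splits only where all factors are positive, which is almost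
  -- everywhere under the law of the sent codeword.
  have hpos : ∀ᵐ y ∂blockVaryingLaw r σ F x, ∀ t j, 0 < ρ (x t j) (y t j) := by
    refine ae_all_iff.2 fun t => ae_all_iff.2 fun j => ?_
    have hq := ((hmp (x t) j).comp
      (measurePreserving_eval (fun t => blockLaw r σ F (x t)) t)).quasiMeasurePreserving
    exact hq.ae (h.ae_pos (x t j))
  refine ENNReal.toReal_mono (measure_ne_top _ _) (measure_mono_ae ?_)
  filter_upwards [hpos] with y hy
  intro hle
  have hle' : ∏ t, ∏ j, ρ (x t j) (y t j) ≤ θ := hle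
  have hprod : 0 < ∏ t, ∏ j, ρ (x t j) (y t j) :=
    Finset.prod_pos fun t _ => Finset.prod_pos fun j _ => hy t j
  have hl := Real.log_le_log hprod hle'
  rw [Real.log_prod fun t _ => (Finset.prod_pos fun j _ => hy t j).ne',
    Finset.sum_congr rfl fun t _ => Real.log_prod fun j _ => (hy t j).ne'] at hl
  change c ≤ |∑ t, Z (x t) (y t) - ∑ t, ∫ v, Z (x t) v ∂blockLaw r σ F (x t)|
  rw [Finset.sum_congr rfl fun t _ => hmean (x t), abs_sub_comm]
  refine le_trans ?_ (le_abs_self _)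
  simp only [hZdef]
  linarith

end Achievability

/-! ### Choice of parameters, degenerate inputs and the two bounds -/

section Main

variable {r : Resistances} {σ : ℝ} {F : PMF unitInterval} {q : unitInterval} {M : ℕ}

theorem tendsto_natCast_mul_div_sq (V : ℝ) {M : ℕ} (hM : 0 < M) {a : ℝ} (ha : 0 < a) :
    Tendsto (fun T : ℕ => (T : ℝ) * V / (M * T * a) ^ 2) atTop (nhds 0) := by
  have hM' : (0 : ℝ) < M := by exact_mod_cast hM
  have h := (tendsto_const_div_atTop_nhds_zero_nat (V / (M * a) ^ 2))
  refine h.congr fun T => ?_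
  rcases T.eq_zero_or_pos with rfl | hT
  · simp
  · have hT' : (0 : ℝ) < T := by exact_mod_cast hT
    field_simp

theorem tendsto_two_mul_exp_neg {M : ℕ} (hM : 0 < M) {a : ℝ} (ha : 0 < a) :
    Tendsto (fun T : ℕ => 2 * Real.exp (-(M * T * a))) atTop (nhds 0) := by
  have hM' : (0 : ℝ) < M := by exact_mod_cast hM
  have h1 : Tendsto (fun T : ℕ => (M : ℝ) * T * a) atTop atTop :=
    (tendsto_natCast_atTop_atTop.const_mul_atTop hM').atTop_mul_const ha
  simpa using (Real.tendsto_exp_neg_atTop_nhds_zero.comp h1).const_mul 2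

theorem exists_blockCode_of_isLikelihood {ρ : Bool → ℝ → ℝ}
    (h : IsLikelihood (esChannel r σ (meanParam F)) q ρ) (h0 : 0 < q) (h1 : q < 1) (hM : 0 < M)
    {δ : ℝ} (hδ : 0 < δ) :
    ∀ᶠ T : ℕ in atTop, ∃ c : BlockCode T M,
      capacityQ r q (meanParam F) σ - δ ≤ c.rate ∧ c.errorProb r σ F ≤ δ ∧ |c.inputProb - q| ≤ δ := by
  classical
  set κ := esChannel r σ (meanParam F)
  set D : Bool → ℝ := fun b => ∫ y, Real.log (ρ b y) ∂κ b with hDdef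
  have : IsProbabilityMeasure ((bernoulliMeasure true false q).bind κ) := inferInstance
  have hD0 : ∀ b, 0 ≤ D b := fun b => (h.relEntropyLE h0 h1 b).nonneg
  set l := Real.log 2 with hl
  have hl0 : 0 < l := Real.log_pos (by norm_num)
  set C := capacityQ r q (meanParam F) σ * l with hC
  have hCD : C = q * D true + (1 - q) * D false := h.mutualInfo_mul_log_two h0 h1
  -- Tolerance for the fraction of ones: within `δ` for the input distribution, and small enough to
  -- shift the expected log-score by at most `n * (δ * l / 4)`.
  set d := min δ (δ * l / 4 / (D false + D true + 1)) with hd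
  have hden : 0 < D false + D true + 1 := by linarith [hD0 false, hD0 true]
  have hd0 : 0 < d := lt_min hδ (by positivity)
  have hdD : d * (D false + D true) ≤ δ * l / 4 := by
    have : d * (D false + D true + 1) ≤ δ * l / 4 := (le_div_iff₀ hden).1 (min_le_right _ _)
    linarith
  obtain ⟨V₁, hV₁⟩ := exists_codewordLaw_variance_bound q M
  obtain ⟨V₂, hV₂⟩ := exists_blockVaryingLaw_score_bound h h0 h1 M
  have ht1 := (tendsto_natCast_mul_div_sq V₁ hM hd0).eventually_le_const
    (show (0 : ℝ) < 1 / 2 by norm_num)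
  have ht2 := ((tendsto_natCast_mul_div_sq V₂ hM (show 0 < δ * l / 4 by positivity)).add
    (tendsto_two_mul_exp_neg hM (show 0 < δ * l / 2 by positivity))).eventually_le_const
    (show (0 : ℝ) + 0 < δ by simpa using hδ)
  filter_upwards [ht1, ht2, eventually_gt_atTop 0] with T hT1 hT2 hT
  have hT' : (0 : ℝ) < T := by exact_mod_cast hT
  have hM' : (0 : ℝ) < M := by exact_mod_cast hM
  set n : ℝ := M * T with hn
  have hn0 : 0 < n := by positivity
  set A : Finset (Fin T → Fin M → Bool) :=
    Finset.univ.filter fun x => |onesCount x - n * q| ≤ n * d with hA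
  set W := ∑ x ∈ A, (codewordLaw q T M).real {x} with hW
  have hWle : 1 / 2 ≤ W := by
    have hWA : W = (codewordLaw q T M).real (A : Set (Fin T → Fin M → Bool)) :=
      sum_measureReal_singleton A
    have hcompl : (codewordLaw q T M).real (A : Set (Fin T → Fin M → Bool))ᶜ ≤ 1 / 2 := by
      refine le_trans (measureReal_mono fun x hx => ?_) ((hV₁ T (n * d) (by positivity)).trans hT1)
      have : ¬ |onesCount x - n * q| ≤ n * d := by simpa [hA] using hx
      exact (not_le.1 this).le
    rw [probReal_compl_eq_one_sub (Set.toFinite _).measurableSet] at hcompl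
    linarith
  have hW0 : 0 < W := by linarith
  -- Of the gap `δ * l / 2` below capacity, half absorbs the input type and half the Chebyshev
  -- deviation. The remaining `δ * l / 2` between `log θ` and the rate makes confusion exponentially
  -- small; the factor `2` there comes from `W ≥ 1 / 2`.
  set θ := Real.exp (n * (C - δ * l / 2)) with hθ
  set K := ⌈Real.exp (n * (C - δ * l))⌉₊ with hK
  have hK0 : 0 < K := Nat.ceil_pos.2 (Real.exp_pos _)
  have hscore : ∀ x ∈ A, (blockVaryingLaw r σ F x).real
      {y | ∏ t, ∏ j, ρ (x t j) (y t j) ≤ θ} ≤ T * V₂ / (n * (δ * l / 4)) ^ 2 := fun x hx => by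
    refine hV₂ T x _ θ (by positivity) (Real.exp_pos _) ?_
    have hx' : |onesCount x - n * q| ≤ n * d := by simpa [hA] using hx
    have hs := sum_symbol_eq_onesCount x D
    rw [hθ, Real.log_exp]
    refine le_trans ?_ (sub_le_sub_right hs.ge _)
    have h2 : |(onesCount x - n * q) * (D true - D false)| ≤ n * (δ * l / 4) := by
      rw [abs_mul]
      calc _ ≤ (n * d) * (D false + D true) := by
            refine mul_le_mul hx' ?_ (abs_nonneg _) (by positivity)
            rw [abs_le]
            constructor <;> linarith [hD0 false, hD0 true]
        _ = n * (d * (D false + D true)) := by ring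
        _ ≤ _ := by gcongr
    have h3 := (abs_le.1 h2).1
    rw [hCD]
    nlinarith
  obtain ⟨enc, dec, hencA, hdec, herr⟩ := exists_codebook (A := A)
    (p := fun x => (codewordLaw q T M).real {x}) (P := fun x => blockVaryingLaw r σ F x)
    (S := fun x y => ∏ t, ∏ j, ρ (x t j) (y t j)) (θ := θ)
    (fun x => measureReal_nonneg) hW0
    (fun x => Finset.measurable_prod _ fun t _ => Finset.measurable_prod _ fun j _ =>
      (h.measurable (x t j)).comp ((measurable_pi_apply j).comp (measurable_pi_apply t)))
    (fun x y => Finset.prod_nonneg fun t _ => Finset.prod_nonneg fun j _ => h.nonneg _ _)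
    (fun y => by
      rw [← sum_codewordLaw_mul_prod h.average y]
      refine Finset.sum_le_sum_of_subset_of_nonneg (Finset.subset_univ _) fun x _ _ => ?_
      exact mul_nonneg measureReal_nonneg
        (Finset.prod_nonneg fun t _ => Finset.prod_nonneg fun j _ => h.nonneg _ _))
    (Real.exp_pos _) hscore hK0
  have hKR : (0 : ℝ) < K := by exact_mod_cast hK0
  have hK1 : (1 : ℝ) ≤ K := by exact_mod_cast hK0
  refine ⟨⟨K, hK0, enc, dec, hdec⟩, ?_, ?_, ?_⟩
  · have hle : Real.exp (n * (C - δ * l)) ≤ K := Nat.le_ceil _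
    have hlog := (Real.le_log_iff_exp_le hKR).2 hle
    rw [BlockCode.rate, Real.logb, le_div_iff₀ hn0, le_div_iff₀ hl0]
    calc _ = n * (C - δ * l) := by rw [hC]; ring
      _ ≤ _ := hlog
  · have hKle : (K : ℝ) - 1 ≤ Real.exp (n * (C - δ * l)) := by
      have := Nat.ceil_lt_add_one (Real.exp_pos (n * (C - δ * l))).le
      linarith
    have hWinv : 1 / θ / W ≤ 2 / θ := by
      rw [div_le_iff₀ hW0]
      have : 0 < 1 / θ := by positivity
      calc 1 / θ = 2 / θ * (1 / 2) := by ring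
        _ ≤ _ := by gcongr
    have hb : ((K : ℝ) - 1) * (1 / θ / W) ≤ 2 * Real.exp (-(n * (δ * l / 2))) := by
      calc _ ≤ Real.exp (n * (C - δ * l)) * (2 / θ) :=
            mul_le_mul hKle hWinv (by positivity) (Real.exp_pos _).le
        _ = 2 * Real.exp (-(n * (δ * l / 2))) := by
            rw [hθ, mul_div_left_comm, ← Real.exp_sub]
            congr 2
            ring
    rw [BlockCode.errorProb, div_le_iff₀ hKR, mul_comm δ]
    refine herr.trans (mul_le_mul_of_nonneg_left ?_ hKR.le)
    linarith
  · refine BlockCode.abs_inputProb_sub_le hT hM _ fun w => ?_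
    have hw : |onesCount (enc w) - n * q| ≤ n * d := by simpa [hA] using hencA w
    exact hw.trans (mul_le_mul_of_nonneg_left (min_le_left _ _) hn0.le)

/-- The code with a single message, all of whose symbols are `b`. -/
theorem isAchievableRate_zero (hM : 0 < M) (b : Bool) (hq : (q : ℝ) = if b = true then 1 else 0) :
    IsAchievableRate r σ F q M 0 := by
  intro δ hδ
  filter_upwards [eventually_gt_atTop 0] with T hT
  refine ⟨⟨1, one_pos, fun _ _ _ => b, fun _ => 0, measurable_const⟩, ?_, ?_, ?_⟩
  · simp [BlockCode.rate, hδ.le]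
  · have h : ∀ w : Fin 1, {y : Fin T → Fin M → ℝ | (0 : Fin 1) ≠ w} = ∅ := fun w => by
      simp [Subsingleton.elim w 0]
    simp [BlockCode.errorProb, h, hδ.le]
  · have hT' : (0 : ℝ) < T := by exact_mod_cast hT
    have hM' : (0 : ℝ) < M := by exact_mod_cast hM
    refine BlockCode.abs_inputProb_sub_le hT hM _ fun w => ?_
    have : onesCount (fun (_ : Fin T) (_ : Fin M) => b) = M * T * q := by
      rw [hq]
      cases b <;> simp [onesCount, mul_comm]
    rw [this, sub_self, abs_zero]
    positivity

theorem eq_zero_or_eq_one_or_mem_Ioo (q : unitInterval) : q = 0 ∨ q = 1 ∨ (0 < q ∧ q < 1) := by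
  rcases eq_or_ne q 0 with h | h
  · exact Or.inl h
  rcases eq_or_ne q 1 with h' | h'
  · exact Or.inr (Or.inl h')
  exact Or.inr (Or.inr ⟨unitInterval.pos_iff_ne_zero.2 h, unitInterval.lt_one_iff_ne_one.2 h'⟩)

theorem capacityQ_zero (r : Resistances) (ε : unitInterval) (σ : ℝ) : capacityQ r 0 ε σ = 0 := by
  rw [capacityQ, bernoulliMeasure_zero, mutualInfo_dirac]

theorem capacityQ_one (r : Resistances) (ε : unitInterval) (σ : ℝ) : capacityQ r 1 ε σ = 0 := by
  rw [capacityQ, bernoulliMeasure_one, mutualInfo_dirac]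

theorem isAchievableRate_capacityQ (hM : 0 < M) :
    IsAchievableRate r σ F q M (capacityQ r q (meanParam F) σ) := by
  rcases eq_zero_or_eq_one_or_mem_Ioo q with rfl | rfl | ⟨h0, h1⟩
  · rw [capacityQ_zero]
    exact isAchievableRate_zero hM false (by simp)
  · rw [capacityQ_one]
    exact isAchievableRate_zero hM true (by simp)
  · obtain ⟨ρ, hρ⟩ := exists_isLikelihood (esChannel r σ (meanParam F)) h0 h1
    exact fun δ hδ => exists_blockCode_of_isLikelihood hρ h0 h1 hM hδ

/-- Upper bound on achievable rates from the output law of an arbitrary Bernoulli(`s`) input. -/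
theorem IsAchievableRate.mul_log_two_le_log_one_div {R : ℝ} (hR : IsAchievableRate r σ F q M R)
    (hM : 0 < M) {s : unitInterval} (h0 : 0 < s) (h1 : s < 1) :
    R * Real.log 2 ≤ (1 - q) * Real.log (1 / (1 - s)) + q * Real.log (1 / s) := by
  refine hR.mul_log_two_le hM (Q := fun ε => (bernoulliMeasure true false s).bind (esChannel r σ ε))
    (D := fun b _ => Real.log (1 / (bif b then (s : ℝ) else 1 - s)))
    (C := fun b => Real.log (1 / (bif b then (s : ℝ) else 1 - s)))
    (fun b => by simpa only [one_mul] using (pmf_hasSum_toReal F).mul_right _) fun ε b => ?_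
  obtain ⟨ρ, hρ⟩ := exists_isLikelihood (esChannel r σ ε) h0 h1
  exact (hρ.relEntropyLE h0 h1 b).mono (hρ.integral_log_le h0 h1 b)

/-- Let `s → 0`. This serves the deterministic inputs, where no interior `q` is available for the
likelihoods: an output law with input Bernoulli(`s`) close to deterministic is the reference
instead. -/
theorem nonpos_of_forall_mul_le_log {R : ℝ}
    (h : ∀ s : ℝ, 0 < s → s < 1 → R * Real.log 2 ≤ Real.log (1 / (1 - s))) : R ≤ 0 := by
  have hlog : 0 < Real.log 2 := Real.log_pos (by norm_num)
  have ht : Tendsto (fun s : ℝ => Real.log (1 / (1 - s))) (nhdsWithin 0 (Set.Ioi 0)) (nhds 0) := by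
    have hc : ContinuousAt (fun s : ℝ => Real.log (1 / (1 - s))) 0 := by
      refine ContinuousAt.log (ContinuousAt.div continuousAt_const (by fun_prop) (by simp)) (by simp)
    simpa [ContinuousAt] using hc.tendsto.mono_left nhdsWithin_le_nhds
  have := ge_of_tendsto ht
    (by filter_upwards [Ioo_mem_nhdsGT (zero_lt_one' ℝ)] with s hs using h s hs.1 hs.2)
  by_contra! hR
  linarith [mul_pos hR hlog]

theorem averageCapacity_nonneg : 0 ≤ averageCapacity r q F σ :=
  tsum_nonneg fun _ => mul_nonneg ENNReal.toReal_nonneg (mutualInfo_nonneg _ _)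

theorem IsAchievableRate.le_averageCapacity {R : ℝ} (hR : IsAchievableRate r σ F q M R)
    (hM : 0 < M) : R ≤ averageCapacity r q F σ := by
  have hlog : 0 < Real.log 2 := Real.log_pos (by norm_num)
  rcases eq_zero_or_eq_one_or_mem_Ioo q with rfl | rfl | ⟨h0, h1⟩
  · refine (nonpos_of_forall_mul_le_log fun s hs0 hs1 => ?_).trans averageCapacity_nonneg
    simpa using hR.mul_log_two_le_log_one_div hM (s := ⟨s, hs0.le, hs1.le⟩) hs0 hs1
  · refine (nonpos_of_forall_mul_le_log fun s hs0 hs1 => ?_).trans averageCapacity_nonneg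
    simpa using hR.mul_log_two_le_log_one_div hM (s := ⟨1 - s, by linarith, by linarith⟩)
      (show (0 : ℝ) < 1 - s by linarith) (show 1 - s < (1 : ℝ) by linarith)
  · choose ρ hρ using fun ε => exists_isLikelihood (esChannel r σ ε) h0 h1
    set D : Bool → unitInterval → ℝ := fun b ε => ∫ y, Real.log (ρ ε b y) ∂esChannel r σ ε b
    have hrel : ∀ ε b, RelEntropyLE (esChannel r σ ε b)
        ((bernoulliMeasure true false q).bind (esChannel r σ ε)) (D b ε) := fun ε b =>
      (hρ ε).relEntropyLE h0 h1 b
    have hsum : ∀ b, Summable fun ε => (F ε).toReal * D b ε := fun b =>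
      pmf_summable_toReal_mul F (B := Real.log (1 / (bif b then (q : ℝ) else 1 - q))) fun ε => by
        rw [abs_of_nonneg (hrel ε b).nonneg]
        exact (hρ ε).integral_log_le h0 h1 b
    have hle := hR.mul_log_two_le hM (fun b => (hsum b).hasSum) hrel
    -- Dividing by `log 2` converts nats to bits; the averages for the two input bits combine into
    -- the average of the mutual informations.
    have hav : HasSum (fun ε => (F ε).toReal * capacityQ r q ε σ)
        (((1 - q) * (∑' ε, (F ε).toReal * D false ε) + q * ∑' ε, (F ε).toReal * D true ε)
          / Real.log 2) := by
      refine ((((hsum false).hasSum.mul_left (1 - q : ℝ)).add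
        ((hsum true).hasSum.mul_left (q : ℝ))).div_const (Real.log 2)).congr_fun ?_
      intro ε
      have := (hρ ε).mutualInfo_mul_log_two h0 h1
      rw [capacityQ, eq_div_of_mul_eq hlog.ne' this]
      simp only [D]
      ring
    rw [averageCapacity, hav.tsum_eq, le_div_iff₀ hlog]
    exact hle

end Main

theorem theorem1 (r : Resistances) (σ : ℝ) (hσ : 0 < σ) (q : unitInterval)
    (M : ℕ) (hM : 0 < M) (F : PMF unitInterval) :
    ∃ R : ℝ, IsGreatest {R' : ℝ | IsAchievableRate r σ F q M R'} R ∧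
      capacityQ r q (meanParam F) σ ≤ R ∧ R ≤ averageCapacity r q F σ := by
  set A := {R' : ℝ | IsAchievableRate r σ F q M R'}
  have hmem : capacityQ r q (meanParam F) σ ∈ A := isAchievableRate_capacityQ hM
  have hub : averageCapacity r q F σ ∈ upperBounds A := fun R hR => hR.le_averageCapacity hM
  have hbdd : BddAbove A := ⟨_, hub⟩
  refine ⟨sSup A, ⟨fun δ hδ => ?_, fun R hR => le_csSup hbdd hR⟩, le_csSup hbdd hmem,
    csSup_le ⟨_, hmem⟩ hub⟩
  -- The supremum is attained: a rate within `δ / 2` of it, used with slack `δ / 2`, gives codes for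
  -- slack `δ`.
  obtain ⟨R, hR, hlt⟩ := exists_lt_of_lt_csSup ⟨_, hmem⟩ (sub_lt_self (sSup A) (half_pos hδ))
  filter_upwards [hR (δ / 2) (half_pos hδ)] with T ⟨c, hc, he, hq⟩
  exact ⟨c, by linarith, by linarith, by linarith⟩
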